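/- Let $(\Sigma,\sigma)$ be a connected (smooth, finite-dimensional) Riemannian manifold with Riemannian distance $d_\sigma$, and let $(\Sigma',\sigma')=(\mathbb{R}\times\Sigma,\,-dt^2\oplus\sigma)$ be its canonical Lorentzian product, time oriented by $\partial_t$. For $p=(p_0,p_\Sigma)\in\Sigma'$ write $t(p)=p_0$. A future (past) directed causal curve is a locally Lipschitz curve on a compact nondegenerate interval whose velocity is, almost everywhere, a nonzero vector $v$ with $\sigma'(v,v)\le 0$ and $\sigma'(v,\partial_t)<0$ (respectively $>0$). Let $J^+(p)$ be the set consisting of $p$ and of all endpoints of future directed causal curves starting at $p$. A curve $\beta$ is piecewise causal if there is a partition $a_0<a_1<\dots<a_k$, $k\ge1$, of its parameter interval such that $\beta$ is a future or a past directed causal curve on each $[a_{i-1},a_i]$; its null length is $\hat L_t(\beta)=\sum_{i=1}^k|t(\beta(a_i))-t(\beta(a_{i-1}))|$. The null distance $\hat d_t(p,q)$ is the infimum of $\hat L_t(\beta)$ over all piecewise causal curves $\beta$ from $p$ to $q$. Then: (i) for all $p,q\in\Sigma'$ there are piecewise causal curves from $p$ to $q$, $d_\sigma(p_\Sigma,q_\Sigma)$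 is finite, and $$\hat d_t(p,q)=\max\{|t(q)-t(p)|,\ d_\sigma(p_\Sigma,q_\Sigma)\};$$ (ii) for all $p,q\in\Sigma'$, $$q\in\partial J^+(p)\iff t(q)-t(p)=\hat d_t(p,q)=d_\sigma(p_\Sigma,q_\Sigma).$$ -/

import Mathlib

open Set MeasureTheory Bundle Manifold
open scoped ContDiff Topology

noncomputable section

section Causality

variable {E : Type*} [NormedAddCommGroup E] [NormedSpace ℝ E] {H : Type*} [TopologicalSpace H]

/-- A nonzero tangent vector `v` is causal for the form `g` if `g(v, v) ≤ 0`. -/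
def IsCausalVector {I : ModelWithCorners ℝ E H} {M : Type*} [TopologicalSpace M]
    [ChartedSpace H M] (g : ∀ x : M, LinearMap.BilinForm ℝ (TangentSpace I x))
    (x : M) (v : TangentSpace I x) : Prop :=
  v ≠ 0 ∧ g x v v ≤ 0

/-- A future directed causal vector: causal with `g(v, X) < 0`, where the timelike vector field
`X` is the time orientation. -/
def IsFutureCausalVector {I : ModelWithCorners ℝ E H} {M : Type*} [TopologicalSpace M]
    [ChartedSpace H M] (g : ∀ x : M, LinearMap.BilinForm ℝ (TangentSpace I x))
    (X : ∀ x : M, TangentSpace I x) (x : M) (v : TangentSpace I x) : Prop :=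
  IsCausalVector g x v ∧ g x v (X x) < 0

/-- A past directed causal vector: causal with `g(v, X) > 0`. -/
def IsPastCausalVector {I : ModelWithCorners ℝ E H} {M : Type*} [TopologicalSpace M]
    [ChartedSpace H M] (g : ∀ x : M, LinearMap.BilinForm ℝ (TangentSpace I x))
    (X : ∀ x : M, TangentSpace I x) (x : M) (v : TangentSpace I x) : Prop :=
  IsCausalVector g x v ∧ 0 < g x v (X x)

/-- The curve `γ : [a, b] → M` (values outside `[a, b]` are irrelevant) is locally Lipschitz: it
is continuous and locally Lipschitz in charts. This is the same as being locally Lipschitz for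
the distance of any Riemannian metric on `M`. -/
def IsLocallyLipschitzCurve (I : ModelWithCorners ℝ E H) {M : Type*} [TopologicalSpace M]
    [ChartedSpace H M] (γ : ℝ → M) (a b : ℝ) : Prop :=
  ContinuousOn γ (Icc a b) ∧
    ∀ s ∈ Icc a b, ∃ K : NNReal, ∃ u ∈ 𝓝[Icc a b] s,
      LipschitzOnWith K (fun r => extChartAt I (γ s) (γ r)) u

/-- A future directed causal curve `γ : [a, b] → M`: locally Lipschitz, with future directed
causal velocity at almost every parameter. -/
def IsFutureCausalCurve {I : ModelWithCorners ℝ E H} {M : Type*} [TopologicalSpace M]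
    [ChartedSpace H M] (g : ∀ x : M, LinearMap.BilinForm ℝ (TangentSpace I x))
    (X : ∀ x : M, TangentSpace I x) (γ : ℝ → M) (a b : ℝ) : Prop :=
  a < b ∧ IsLocallyLipschitzCurve I γ a b ∧
    ∀ᵐ s : ℝ, s ∈ Ioo a b → MDifferentiableAt 𝓘(ℝ, ℝ) I γ s ∧
      IsFutureCausalVector g X (γ s) (mfderiv 𝓘(ℝ, ℝ) I γ s (1 : ℝ))

/-- A past directed causal curve `γ : [a, b] → M`. -/
def IsPastCausalCurve {I : ModelWithCorners ℝ E H} {M : Type*} [TopologicalSpace M]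
    [ChartedSpace H M] (g : ∀ x : M, LinearMap.BilinForm ℝ (TangentSpace I x))
    (X : ∀ x : M, TangentSpace I x) (γ : ℝ → M) (a b : ℝ) : Prop :=
  a < b ∧ IsLocallyLipschitzCurve I γ a b ∧
    ∀ᵐ s : ℝ, s ∈ Ioo a b → MDifferentiableAt 𝓘(ℝ, ℝ) I γ s ∧
      IsPastCausalVector g X (γ s) (mfderiv 𝓘(ℝ, ℝ) I γ s (1 : ℝ))

/-- The causal future `J⁺(p)`. -/
def causalFuture {I : ModelWithCorners ℝ E H} {M : Type*} [TopologicalSpace M]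
    [ChartedSpace H M] (g : ∀ x : M, LinearMap.BilinForm ℝ (TangentSpace I x))
    (X : ∀ x : M, TangentSpace I x) (p : M) : Set M :=
  {q | q = p ∨ ∃ (γ : ℝ → M) (a b : ℝ), IsFutureCausalCurve g X γ a b ∧ γ a = p ∧ γ b = q}

/-- The curve `β : [a 0, a k] → M` is piecewise causal with respect to the partition
`a 0 < a 1 < ⋯ < a k`, `k ≥ 1`: on each subinterval it is a future directed or a past directed
causal curve. -/
def IsPiecewiseCausal {I : ModelWithCorners ℝ E H} {M : Type*} [TopologicalSpace M]
    [ChartedSpace H M] (g : ∀ x : M, LinearMap.BilinForm ℝ (TangentSpace I x))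
    (X : ∀ x : M, TangentSpace I x) (β : ℝ → M) (k : ℕ) (a : ℕ → ℝ) : Prop :=
  1 ≤ k ∧ ∀ i < k, IsFutureCausalCurve g X β (a i) (a (i + 1)) ∨
    IsPastCausalCurve g X β (a i) (a (i + 1))

/-- The null length of `β` with respect to the function `τ` and the partition
`a 0 < a 1 < ⋯ < a k`. -/
def nullLength {M : Type*} (τ : M → ℝ) (β : ℝ → M) (k : ℕ) (a : ℕ → ℝ) : ℝ :=
  ∑ i ∈ Finset.range k, |τ (β (a (i + 1))) - τ (β (a i))|

/-- The set of null lengths of piecewise causal curves from `p` to `q`. -/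
def nullLengths {I : ModelWithCorners ℝ E H} {M : Type*} [TopologicalSpace M]
    [ChartedSpace H M] (g : ∀ x : M, LinearMap.BilinForm ℝ (TangentSpace I x))
    (X : ∀ x : M, TangentSpace I x) (τ : M → ℝ) (p q : M) : Set ℝ :=
  {L | ∃ (β : ℝ → M) (k : ℕ) (a : ℕ → ℝ), IsPiecewiseCausal g X β k a ∧
    β (a 0) = p ∧ β (a k) = q ∧ L = nullLength τ β k a}

/-- The null distance of `τ`. (The set of null lengths is bounded below by `0`; the infimum is
meaningful where that set is nonempty.) -/
def nullDist {I : ModelWithCorners ℝ E H} {M : Type*} [TopologicalSpace M]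
    [ChartedSpace H M] (g : ∀ x : M, LinearMap.BilinForm ℝ (TangentSpace I x))
    (X : ∀ x : M, TangentSpace I x) (τ : M → ℝ) (p q : M) : ℝ :=
  sInf (nullLengths g X τ p q)

end Causality

section Product

variable {E : Type*} [NormedAddCommGroup E] [NormedSpace ℝ E] {H : Type*} [TopologicalSpace H]

/-- The differential `dt` of the projection `ℝ × S → ℝ`. -/
def dtForm (I : ModelWithCorners ℝ E H) {S : Type*} [TopologicalSpace S]
    [ChartedSpace H S] (p : ℝ × S) : TangentSpace (𝓘(ℝ, ℝ).prod I) p →ₗ[ℝ] ℝ :=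
  (mfderiv (𝓘(ℝ, ℝ).prod I) 𝓘(ℝ, ℝ) (Prod.fst : ℝ × S → ℝ) p).toLinearMap

/-- The differential of the projection `ℝ × S → S`. -/
def dProj (I : ModelWithCorners ℝ E H) {S : Type*} [TopologicalSpace S]
    [ChartedSpace H S] (p : ℝ × S) :
    TangentSpace (𝓘(ℝ, ℝ).prod I) p →ₗ[ℝ] TangentSpace I p.2 :=
  (mfderiv (𝓘(ℝ, ℝ).prod I) I (Prod.snd : ℝ × S → S) p).toLinearMap

/-- The Lorentzian product metric `-dt² ⊕ σ` on `ℝ × S`, for the Riemannian metric `σ` on `S`. -/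
def productMetric (I : ModelWithCorners ℝ E H) {S : Type*} [TopologicalSpace S]
    [ChartedSpace H S] [RiemannianBundle (fun x : S => TangentSpace I x)] (p : ℝ × S) :
    LinearMap.BilinForm ℝ (TangentSpace (𝓘(ℝ, ℝ).prod I) p) :=
  LinearMap.mk₂ ℝ
    (fun v w => -(dtForm I p v * dtForm I p w) + inner ℝ (dProj I p v) (dProj I p w))
    (fun v v' w => by simp only [map_add, inner_add_left]; ring)
    (fun c v w => by simp only [map_smul, real_inner_smul_left, smul_eq_mul]; ring)
    (fun v w w' => by simp only [map_add, inner_add_right]; ring)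
    (fun c v w => by simp only [map_smul, real_inner_smul_right, smul_eq_mul]; ring)

/-- The vector field `∂ₜ` on `ℝ × S`, which is the time orientation of the Lorentzian product. The
tangent space of `ℝ × S` at `p` is `ℝ × TangentSpace I p.2`. -/
def timeField (I : ModelWithCorners ℝ E H) {S : Type*} [TopologicalSpace S]
    [ChartedSpace H S] (p : ℝ × S) : TangentSpace (𝓘(ℝ, ℝ).prod I) p :=
  ((1, 0) : ℝ × TangentSpace I p.2)

/-- The canonical time function `t(p₀, p_S) = p₀`. -/
def timeCoord {S : Type*} (p : ℝ × S) : ℝ := p.1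

/-- The Riemannian distance: the infimum of the lengths of `C¹` curves (meaningful where the
extended distance is finite). -/
def riemannianDist (I : ModelWithCorners ℝ E H) {S : Type*} [TopologicalSpace S]
    [ChartedSpace H S] [RiemannianBundle (fun x : S => TangentSpace I x)] (x y : S) : ℝ :=
  (riemannianEDist I x y).toReal

end Product

end

/-! Since `g(v, v) = -dt(v)² + ‖v_Σ‖²` and `g(v, ∂ₜ) = -dt(v)`, a vector is future (past) causal
exactly when `dt(v)` is positive (negative) and `‖v_Σ‖ ≤ |dt(v)|`. Hence on each causal piece the
time difference dominates the spatial distance of the endpoints, and the triangle inequality for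
both quantities shows that every null length is at least the maximum.

Causal curves are only Lipschitz, whereas the distance is an infimum over `C¹` curves. The bridge is
`riemannianDist_le_sub_of_speed_le_deriv`: the distance from the initial point is Lipschitz along
the curve, its derivative is at most the speed (a local chart estimate), and the fundamental theorem
of calculus for absolutely continuous functions gives the bound.

Conversely, for `Λ` above the maximum, take a `C¹` curve of length less than `Λ` in the base and a
clock `F` that outruns its arc length, with total increment `Λ`. Letting time first rise and then
fall at the rate of `F` gives a zigzag of null length exactly `Λ`; the turning point adjusts the
final time.

For (ii), the causal future lies between the open set `d < Δt` and the closed set `d ≤ Δt`. This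
suffices for the boundary although, without completeness, minimizing curves may be missing and the
future need not be closed. -/

/-! ### Riemannian length and distance in a chart -/

section LocalDistance

variable {E : Type*} [NormedAddCommGroup E] [NormedSpace ℝ E]
  {S : Type*} [TopologicalSpace S] [ChartedSpace E S] [IsManifold 𝓘(ℝ, E) 1 S]
  [RiemannianBundle (fun x : S => TangentSpace 𝓘(ℝ, E) x)]
  [IsContinuousRiemannianBundle E (fun x : S => TangentSpace 𝓘(ℝ, E) x)]

/-- The speed of a `C¹` curve in a manifold with a continuous Riemannian metric is continuous. -/
lemma ContMDiff.continuous_speed {γ : ℝ → S} (hγ : ContMDiff 𝓘(ℝ, ℝ) 𝓘(ℝ, E) 1 γ) :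
    Continuous fun s : ℝ => ‖mfderiv 𝓘(ℝ, ℝ) 𝓘(ℝ, E) γ s (1 : ℝ)‖ := by
  have h1 : Continuous fun s : ℝ => (⟨s, (1 : ℝ)⟩ : TangentBundle 𝓘(ℝ, ℝ) ℝ) :=
    (tangentBundleModelSpaceHomeomorph 𝓘(ℝ, ℝ)).symm.continuous.comp
      (f := fun s : ℝ => ((s, (1 : ℝ)) : ℝ × ℝ)) (by fun_prop)
  have h2 := (hγ.continuous_tangentMap le_rfl).comp h1
  -- The norms live on varying fibres, so continuity passes through the bundle inner product.
  have h3 : Continuous fun s : ℝ => inner ℝ (mfderiv 𝓘(ℝ, ℝ) 𝓘(ℝ, E) γ s (1 : ℝ))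
      (mfderiv 𝓘(ℝ, ℝ) 𝓘(ℝ, E) γ s (1 : ℝ)) :=
    Continuous.inner_bundle (F := E) (E := fun x : S => TangentSpace 𝓘(ℝ, E) x)
      (b := γ) h2 h2
  simpa only [norm_eq_sqrt_real_inner] using h3.sqrt

/-- The Riemannian norm of a vector, read in a chart, is jointly continuous. -/
lemma exists_ball_norm_mfderiv_extChartAt_symm_lt (x : S) (v : E) {c : ℝ}
    (hc : ‖mfderiv 𝓘(ℝ, E) 𝓘(ℝ, E) (extChartAt 𝓘(ℝ, E) x).symm (extChartAt 𝓘(ℝ, E) x x) v‖ < c) :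
    ∃ r > 0, Metric.ball (extChartAt 𝓘(ℝ, E) x x) r ⊆ (extChartAt 𝓘(ℝ, E) x).target ∧
      ∀ u ∈ Metric.ball (extChartAt 𝓘(ℝ, E) x x) r, ∀ w ∈ Metric.ball v r,
        ‖mfderiv 𝓘(ℝ, E) 𝓘(ℝ, E) (extChartAt 𝓘(ℝ, E) x).symm u w‖ < c := by
  have hopen := isOpen_extChartAt_target (I := 𝓘(ℝ, E)) x
  have h0 : extChartAt 𝓘(ℝ, E) x x ∈ (extChartAt 𝓘(ℝ, E) x).target :=
    mem_extChartAt_target x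
  have h1 := (contMDiffOn_extChartAt_symm (I := 𝓘(ℝ, E)) (n := 1) x).continuousOn_tangentMapWithin
    le_rfl hopen.uniqueMDiffOn
  have h2 : Continuous fun z : E × E => (⟨z.1, z.2⟩ : TangentBundle 𝓘(ℝ, E) E) :=
    (tangentBundleModelSpaceHomeomorph 𝓘(ℝ, E)).symm.continuous
  have h3 : ContinuousAt (fun z : E × E =>
      (⟨(extChartAt 𝓘(ℝ, E) x).symm z.1,
        mfderiv 𝓘(ℝ, E) 𝓘(ℝ, E) (extChartAt 𝓘(ℝ, E) x).symm z.1 z.2⟩ : TangentBundle 𝓘(ℝ, E) S))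
      (extChartAt 𝓘(ℝ, E) x x, v) := by
    have h4 := (h1.comp h2.continuousOn (s := Prod.fst ⁻¹' (extChartAt 𝓘(ℝ, E) x).target)
      (fun z hz => hz)).continuousAt
        ((hopen.preimage continuous_fst).mem_nhds (show (extChartAt 𝓘(ℝ, E) x x, v).1 ∈ _ from h0))
    refine h4.congr ?_
    filter_upwards [(hopen.preimage continuous_fst).mem_nhds
      (show (extChartAt 𝓘(ℝ, E) x x, v).1 ∈ _ from h0)] with z hz
    simp only [Function.comp, tangentMapWithin]
    rw [mfderivWithin_of_isOpen hopen hz]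
  have h5 := (ContinuousAt.inner_bundle (F := E) (E := fun x : S => TangentSpace 𝓘(ℝ, E) x)
    (b := fun z : E × E => (extChartAt 𝓘(ℝ, E) x).symm z.1) h3 h3).sqrt
  simp only [← norm_eq_sqrt_real_inner] at h5
  have h6 := h5.eventually_lt_const hc
  have h7 := h6.and ((hopen.preimage continuous_fst).mem_nhds
    (show (extChartAt 𝓘(ℝ, E) x x, v).1 ∈ _ from h0))
  obtain ⟨r, hr, h⟩ := Metric.eventually_nhds_iff_ball.1 h7
  simp only [← ball_prod_same] at h
  exact ⟨r, hr, fun u hu => (h (u, v) ⟨hu, Metric.mem_ball_self hr⟩).2,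
    fun u hu w hw => (h (u, w) ⟨hu, hw⟩).1⟩

/-- The Riemannian distance between two points is bounded by the length of the segment between
them in a chart. -/
lemma exists_ball_riemannianEDist_extChartAt_symm_le (x : S) (v : E) {c : ℝ}
    (hc : ‖mfderiv 𝓘(ℝ, E) 𝓘(ℝ, E) (extChartAt 𝓘(ℝ, E) x).symm (extChartAt 𝓘(ℝ, E) x x) v‖ < c) :
    ∃ r > 0, ∀ u ∈ Metric.ball (extChartAt 𝓘(ℝ, E) x x) r, ∀ w ∈ Metric.ball v r, ∀ h : ℝ, 0 ≤ h →
      u + h • w ∈ Metric.ball (extChartAt 𝓘(ℝ, E) x x) r →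
      riemannianEDist 𝓘(ℝ, E) ((extChartAt 𝓘(ℝ, E) x).symm u)
        ((extChartAt 𝓘(ℝ, E) x).symm (u + h • w)) ≤ ENNReal.ofReal (c * h) := by
  obtain ⟨r, hr, hsub, hlt⟩ := exists_ball_norm_mfderiv_extChartAt_symm_lt x v hc
  refine ⟨r, hr, fun u hu w hw h hh huh => ?_⟩
  set φ := extChartAt 𝓘(ℝ, E) x with hφ
  have hη : ContMDiff 𝓘(ℝ, ℝ) 𝓘(ℝ, E) 1 fun t : ℝ => u + t • w := by
    rw [contMDiff_iff_contDiff]; fun_prop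
  have hmem : ∀ t ∈ Icc 0 h, u + t • w ∈ Metric.ball (φ x) r := by
    intro t ht
    rcases hh.eq_or_lt with rfl | hpos
    · obtain rfl : t = 0 := le_antisymm ht.2 ht.1
      simpa using hu
    · have := (convex_ball (φ x) r).add_smul_mem hu huh (t := t / h)
        ⟨div_nonneg ht.1 hh, div_le_one_of_le₀ ht.2 hh⟩
      rwa [smul_smul, div_mul_cancel₀ _ hpos.ne'] at this
  have hγ : ContMDiffOn 𝓘(ℝ, ℝ) 𝓘(ℝ, E) 1 (fun t : ℝ => φ.symm (u + t • w)) (Icc 0 h) :=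
    (contMDiffOn_extChartAt_symm x).comp hη.contMDiffOn fun t ht => hsub (hmem t ht)
  refine (riemannianEDist_le_pathELength hγ (by simp) rfl hh).trans ?_
  -- On the open interval the length uses the two-sided derivative, to which the chain rule applies.
  rw [pathELength_eq_lintegral_mfderiv_Ioo]
  have hbound : ∀ t ∈ Ioo 0 h,
      ‖mfderiv 𝓘(ℝ, ℝ) 𝓘(ℝ, E) (fun t : ℝ => φ.symm (u + t • w)) t (1 : ℝ)‖ₑ
        ≤ ENNReal.ofReal c := by
    intro t ht
    have ht' := hmem t (Ioo_subset_Icc_self ht)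
    have d1 : HasMFDerivAt 𝓘(ℝ, ℝ) 𝓘(ℝ, E) (fun t : ℝ => u + t • w) t
        (ContinuousLinearMap.toSpanSingleton ℝ w) := by
      have : HasDerivAt (fun t : ℝ => u + t • w) w t := by
        simpa using ((hasDerivAt_id t).smul_const w).const_add u
      exact this.hasFDerivAt.hasMFDerivAt
    have d2 : MDifferentiableAt 𝓘(ℝ, E) 𝓘(ℝ, E) φ.symm (u + t • w) :=
      ((contMDiffOn_extChartAt_symm (n := 1) x).contMDiffAt
        ((isOpen_extChartAt_target x).mem_nhds (hsub ht'))).mdifferentiableAt one_ne_zero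
    have d3 := HasMFDerivAt.comp t d2.hasMFDerivAt d1
    have d4 := d3.mfderiv
    have d5 : mfderiv 𝓘(ℝ, ℝ) 𝓘(ℝ, E) (fun t : ℝ => φ.symm (u + t • w)) t (1 : ℝ) =
        mfderiv 𝓘(ℝ, E) 𝓘(ℝ, E) φ.symm (u + t • w) w := by
      have := congrArg (fun L => L (1 : ℝ)) d4
      refine this.trans ?_
      change mfderiv 𝓘(ℝ, E) 𝓘(ℝ, E) φ.symm (u + t • w) ((1 : ℝ) • w) = _
      rw [one_smul]
    rw [d5, ← ofReal_norm]
    exact ENNReal.ofReal_le_ofReal (hlt _ ht' _ hw).le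
  refine (setLIntegral_mono' measurableSet_Ioo hbound).trans ?_
  have hc0 : 0 ≤ c := (norm_nonneg _).trans hc.le
  simp [ENNReal.ofReal_mul hc0]

end LocalDistance

/-! ### Elementary properties of the distance -/

section DistanceBasic

variable {E : Type*} [NormedAddCommGroup E] [NormedSpace ℝ E]
  {S : Type*} [TopologicalSpace S] [ChartedSpace E S]
  [RiemannianBundle (fun x : S => TangentSpace 𝓘(ℝ, E) x)]

lemma riemannianDist_nonneg (x y : S) : 0 ≤ riemannianDist 𝓘(ℝ, E) x y :=
  ENNReal.toReal_nonneg

lemma riemannianDist_self (x : S) : riemannianDist 𝓘(ℝ, E) x x = 0 := by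
  simp [riemannianDist, riemannianEDist_self]

lemma riemannianDist_comm (x y : S) :
    riemannianDist 𝓘(ℝ, E) x y = riemannianDist 𝓘(ℝ, E) y x := by
  simp only [riemannianDist, riemannianEDist_comm (x := x)]

lemma riemannianDist_le_of_edist_le {x y : S} {c : ℝ} (hc : 0 ≤ c)
    (h : riemannianEDist 𝓘(ℝ, E) x y ≤ ENNReal.ofReal c) : riemannianDist 𝓘(ℝ, E) x y ≤ c :=
  ENNReal.toReal_le_of_le_ofReal hc h

end DistanceBasic

/-! ### Finiteness of the distance and its growth along Lipschitz curves -/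

section DistanceAlongCurves

variable {E : Type*} [NormedAddCommGroup E] [NormedSpace ℝ E]
  {S : Type*} [TopologicalSpace S] [ChartedSpace E S] [IsManifold 𝓘(ℝ, E) 1 S]
  [RiemannianBundle (fun x : S => TangentSpace 𝓘(ℝ, E) x)]
  [IsContinuousRiemannianBundle E (fun x : S => TangentSpace 𝓘(ℝ, E) x)]

/-- On a connected manifold, the Riemannian distance is finite. -/
lemma riemannianEDist_ne_top [ConnectedSpace S] (x y : S) :
    riemannianEDist 𝓘(ℝ, E) x y ≠ ⊤ := by
  have hnear : ∀ z : S, ∀ᶠ w in 𝓝 z, riemannianEDist 𝓘(ℝ, E) z w < 1 := fun z =>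
    eventually_riemannianEDist_lt 𝓘(ℝ, E) z one_pos
  -- Every point has a neighbourhood at distance below `1` from it, so finiteness of the distance to
  -- `x` is both an open and a closed condition.
  have hclopen : IsClopen {z : S | riemannianEDist 𝓘(ℝ, E) x z < ⊤} := by
    constructor
    · rw [← isOpen_compl_iff, isOpen_iff_mem_nhds]
      intro z hz
      filter_upwards [hnear z] with w hw hxw
      refine hz (lt_of_le_of_lt (riemannianEDist_triangle (y := w)) ?_)
      rw [riemannianEDist_comm (x := w)]
      exact ENNReal.add_lt_top.2 ⟨hxw, hw.trans ENNReal.one_lt_top⟩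
    · rw [isOpen_iff_mem_nhds]
      intro z hz
      filter_upwards [hnear z] with w hw
      exact lt_of_le_of_lt (riemannianEDist_triangle (y := z))
        (ENNReal.add_lt_top.2 ⟨hz, hw.trans ENNReal.one_lt_top⟩)
  have huniv := hclopen.eq_univ ⟨x, by simp [riemannianEDist_self]⟩
  have hy : y ∈ {z : S | riemannianEDist 𝓘(ℝ, E) x z < ⊤} := huniv ▸ mem_univ y
  exact hy.ne

lemma riemannianDist_triangle [ConnectedSpace S] (x y z : S) :
    riemannianDist 𝓘(ℝ, E) x z ≤ riemannianDist 𝓘(ℝ, E) x y + riemannianDist 𝓘(ℝ, E) y z := by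
  simp only [riemannianDist]
  rw [← ENNReal.toReal_add (riemannianEDist_ne_top x y) (riemannianEDist_ne_top y z)]
  exact ENNReal.toReal_mono (ENNReal.add_ne_top.2
    ⟨riemannianEDist_ne_top x y, riemannianEDist_ne_top y z⟩) riemannianEDist_triangle

lemma abs_riemannianDist_sub_le [ConnectedSpace S] (x y z : S) :
    |riemannianDist 𝓘(ℝ, E) x y - riemannianDist 𝓘(ℝ, E) x z| ≤ riemannianDist 𝓘(ℝ, E) y z := by
  have h1 := riemannianDist_triangle (E := E) x y z
  have h2 := riemannianDist_triangle (E := E) x z y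
  rw [riemannianDist_comm (E := E) z y] at h2
  exact abs_le.2 ⟨by linarith, by linarith⟩

lemma continuous_riemannianDist [ConnectedSpace S] (x : S) :
    Continuous (riemannianDist 𝓘(ℝ, E) x) := by
  rw [continuous_iff_continuousAt]
  intro y
  rw [Metric.continuousAt_iff']
  intro ε hε
  filter_upwards [eventually_riemannianEDist_lt 𝓘(ℝ, E) y (ENNReal.ofReal_pos.2 hε)] with z hz
  rw [Real.dist_eq]
  refine (abs_riemannianDist_sub_le (E := E) x z y).trans_lt ?_
  rw [riemannianDist_comm]
  exact (ENNReal.lt_ofReal_iff_toReal_lt (riemannianEDist_ne_top y z)).1 hz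

/-- In a chart, the Riemannian distance is locally Lipschitz. -/
lemma exists_lipschitzOnWith_riemannianDist_comp [ConnectedSpace S] (x : S) {c : ℝ → S}
    {t : Set ℝ} {s : ℝ} (hcont : ContinuousWithinAt c t s) {K : NNReal} {u : Set ℝ}
    (hu : u ∈ 𝓝[t] s) (hK : LipschitzOnWith K (fun r => extChartAt 𝓘(ℝ, E) (c s) (c r)) u) :
    ∃ K' : NNReal, ∃ u' ∈ 𝓝[t] s,
      LipschitzOnWith K' (fun r => riemannianDist 𝓘(ℝ, E) x (c r)) u' := by
  obtain ⟨r, hr, hball⟩ := exists_ball_riemannianEDist_extChartAt_symm_le (E := E) (c s) 0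
    (c := 1) (by
      refine lt_of_eq_of_lt ?_ one_pos
      exact (congrArg norm (ContinuousLinearMap.map_zero _)).trans norm_zero)
  set φ := extChartAt 𝓘(ℝ, E) (c s) with hφ
  have h1 : ∀ᶠ q in 𝓝[t] s, c q ∈ φ.source :=
    hcont.eventually (extChartAt_source_mem_nhds (c s))
  have h2 : ∀ᶠ q in 𝓝[t] s, φ (c q) ∈ Metric.ball (φ (c s)) r :=
    ((continuousAt_extChartAt (c s)).comp_continuousWithinAt hcont).eventually
      (Metric.ball_mem_nhds _ hr)
  -- Chart vectors of norm below `r` have Riemannian norm below `1`. A displacement of norm `n` is a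
  -- vector of norm `r / 2` run for time `2 / r * n`, whence the factor `2 / r`.
  refine ⟨Real.toNNReal (2 / r * K), _, Filter.inter_mem hu (h1.and h2), ?_⟩
  refine LipschitzOnWith.of_dist_le_mul ?_
  rw [Real.coe_toNNReal _ (by positivity)]
  rintro p ⟨hpu, hp1, hp2⟩ q ⟨hqu, hq1, hq2⟩
  rw [Real.dist_eq]
  refine (abs_riemannianDist_sub_le (E := E) x (c p) (c q)).trans ?_
  have hd : riemannianDist 𝓘(ℝ, E) (c p) (c q) ≤ 2 / r * ‖φ (c q) - φ (c p)‖ := by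
    set n := ‖φ (c q) - φ (c p)‖ with hn
    refine riemannianDist_le_of_edist_le (by positivity) ?_
    rcases eq_or_ne n 0 with h0 | h0
    · have : c q = c p := φ.injOn hq1 hp1 (sub_eq_zero.1 (norm_eq_zero.1 h0))
      simp [this, riemannianEDist_self]
    · have hn0 : 0 < n := lt_of_le_of_ne (norm_nonneg _) h0.symm
      have e : φ (c p) + (2 / r * n) • ((2 / r * n)⁻¹ • (φ (c q) - φ (c p))) = φ (c q) := by
        rw [smul_inv_smul₀ (by positivity)]; abel
      have := hball (φ (c p)) hp2 ((2 / r * n)⁻¹ • (φ (c q) - φ (c p)))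
        (by
          rw [mem_ball_zero_iff, norm_smul, ← hn, norm_inv, Real.norm_eq_abs,
            abs_of_pos (by positivity)]
          field_simp
          linarith) (2 / r * n) (by positivity) (by rwa [e])
      rw [e, φ.left_inv hp1, φ.left_inv hq1, one_mul] at this
      exact this
  refine hd.trans ?_
  have := hK.dist_le_mul p hpu q hqu
  rw [dist_comm (φ (c p)), dist_eq_norm] at this
  calc 2 / r * ‖φ (c q) - φ (c p)‖ ≤ 2 / r * (K * dist p q) := by gcongr
    _ = _ := by rw [mul_assoc]

/-- The distance to a fixed point grows along a curve at most at the speed of the curve. -/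
lemma deriv_riemannianDist_comp_le [ConnectedSpace S] (x : S) {c : ℝ → S} {s : ℝ}
    (hc : MDifferentiableAt 𝓘(ℝ, ℝ) 𝓘(ℝ, E) c s)
    (hf : DifferentiableAt ℝ (fun r => riemannianDist 𝓘(ℝ, E) x (c r)) s) :
    deriv (fun r => riemannianDist 𝓘(ℝ, E) x (c r)) s ≤
      ‖mfderiv 𝓘(ℝ, ℝ) 𝓘(ℝ, E) c s (1 : ℝ)‖ := by
  refine le_of_forall_gt_imp_ge_of_dense fun M hM => ?_
  set φ := extChartAt 𝓘(ℝ, E) (c s) with hφ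
  have hφd : MDifferentiableAt 𝓘(ℝ, E) 𝓘(ℝ, E) φ (c s) :=
    mdifferentiableAt_extChartAt (mem_chart_source E (c s))
  have hψ := HasMFDerivAt.comp s hφd.hasMFDerivAt hc.hasMFDerivAt
  set v : E := mfderiv 𝓘(ℝ, E) 𝓘(ℝ, E) φ (c s) (mfderiv 𝓘(ℝ, ℝ) 𝓘(ℝ, E) c s (1 : ℝ)) with hv
  have hψd : HasDerivAt (φ ∘ c) v s := by
    have h : HasFDerivAt (φ ∘ c) (_ : ℝ →L[ℝ] E) s := hψ.hasFDerivAt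
    exact h.hasDerivAt
  have hsource : ∀ᶠ q in 𝓝 s, c q ∈ φ.source :=
    hc.continuousAt.eventually (extChartAt_source_mem_nhds (c s))
  have hnorm : ‖mfderiv 𝓘(ℝ, E) 𝓘(ℝ, E) φ.symm (φ (c s)) v‖ =
      ‖mfderiv 𝓘(ℝ, ℝ) 𝓘(ℝ, E) c s (1 : ℝ)‖ := by
    have d2 : MDifferentiableAt 𝓘(ℝ, E) 𝓘(ℝ, E) φ.symm ((φ ∘ c) s) :=
      ((contMDiffOn_extChartAt_symm (n := 1) (c s)).contMDiffAt
        ((isOpen_extChartAt_target (c s)).mem_nhds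
          (mem_extChartAt_target (c s)))).mdifferentiableAt one_ne_zero
    have d3 := HasMFDerivAt.comp s d2.hasMFDerivAt hψ
    have heq : φ.symm ∘ φ ∘ c =ᶠ[𝓝 s] c := by
      filter_upwards [hsource] with q hq using φ.left_inv hq
    have d4 := (d3.congr_of_eventuallyEq heq.symm).mfderiv
    -- The base points `φ.symm (φ (c s))` and `c s` are equal only propositionally, so the norm has
    -- to be carried from one fibre to the other.
    have key : ∀ y : S, y = c s → ∀ w : E,
        @norm (TangentSpace 𝓘(ℝ, E) y) _ w = @norm (TangentSpace 𝓘(ℝ, E) (c s)) _ w := by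
      rintro y rfl w; rfl
    exact (key _ (φ.left_inv (mem_extChartAt_source (c s))) _).trans
      (congrArg (fun L => @norm (TangentSpace 𝓘(ℝ, E) (c s)) _ (L (1 : ℝ))) d4).symm
  obtain ⟨r, hr, hball⟩ := exists_ball_riemannianEDist_extChartAt_symm_le (E := E) (c s) v
    (c := M) (hnorm.trans_lt hM)
  have hM0 : 0 ≤ M := (norm_nonneg _).trans hM.le
  have hshift : Filter.Tendsto (fun h : ℝ => s + h) (𝓝[>] 0) (𝓝 s) := by
    have : Filter.Tendsto (fun h : ℝ => s + h) (𝓝 0) (𝓝 (s + 0)) :=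
      (continuous_const.add continuous_id).tendsto 0
    rw [add_zero] at this
    exact this.mono_left nhdsWithin_le_nhds
  have e1 : ∀ᶠ h in 𝓝[>] (0 : ℝ), h⁻¹ • ((φ ∘ c) (s + h) - (φ ∘ c) s) ∈ Metric.ball v r :=
    hψd.tendsto_slope_zero_right.eventually (Metric.ball_mem_nhds _ hr)
  have e2 : ∀ᶠ h in 𝓝[>] (0 : ℝ), (φ ∘ c) (s + h) ∈ Metric.ball (φ (c s)) r :=
    (hψd.continuousAt.tendsto.comp hshift).eventually (Metric.ball_mem_nhds _ hr)
  have e3 : ∀ᶠ h in 𝓝[>] (0 : ℝ), c (s + h) ∈ φ.source := hshift.eventually hsource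
  -- The derivative exists, so right difference quotients suffice. For small `h > 0` the chart
  -- quotient is close to the velocity `v`, and the segment estimate bounds the distance from `c s`
  -- to `c (s + h)` by `M * h`.
  refine le_of_tendsto hf.hasDerivAt.tendsto_slope_zero_right ?_
  filter_upwards [e1, e2, e3, self_mem_nhdsWithin] with h h1 h2 h3 (h4 : 0 < h)
  have e : φ (c s) + h • (h⁻¹ • (φ (c (s + h)) - φ (c s))) = φ (c (s + h)) := by
    rw [smul_inv_smul₀ h4.ne']; abel
  have := hball (φ (c s)) (Metric.mem_ball_self hr) _ h1 h h4.le
    (by simp only [Function.comp] at h2 ⊢; rwa [e])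
  simp only [Function.comp] at this
  rw [e, φ.left_inv (mem_extChartAt_source (c s)), φ.left_inv h3] at this
  have h5 := riemannianDist_le_of_edist_le (by positivity) this
  have h6 := (abs_le.1 (abs_riemannianDist_sub_le (E := E) x (c s) (c (s + h)))).1
  rw [smul_eq_mul, inv_mul_le_iff₀ h4]
  linarith

/-- A locally Lipschitz curve whose speed is bounded by the derivative of `τ` joins points at
distance at most the increment of `τ`. -/
lemma riemannianDist_le_sub_of_speed_le_deriv [ConnectedSpace S] {c : ℝ → S} {τ : ℝ → ℝ} {a b : ℝ}
    (hab : a < b) (hcont : ContinuousOn c (Icc a b))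
    (hc : ∀ s ∈ Icc a b, ∃ K : NNReal, ∃ u ∈ 𝓝[Icc a b] s,
      LipschitzOnWith K (fun r => extChartAt 𝓘(ℝ, E) (c s) (c r)) u)
    (hτ : LocallyLipschitzOn (Icc a b) τ)
    (hae : ∀ᵐ s : ℝ, s ∈ Ioo a b → MDifferentiableAt 𝓘(ℝ, ℝ) 𝓘(ℝ, E) c s ∧
      DifferentiableAt ℝ τ s ∧ ‖mfderiv 𝓘(ℝ, ℝ) 𝓘(ℝ, E) c s (1 : ℝ)‖ ≤ deriv τ s) :
    riemannianDist 𝓘(ℝ, E) (c a) (c b) ≤ τ b - τ a := by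
  -- Both `f` and `τ` are Lipschitz on the compact interval, hence absolutely continuous, and `f' ≤
  -- speed ≤ τ'` almost everywhere; integrate.
  set f : ℝ → ℝ := fun r => riemannianDist 𝓘(ℝ, E) (c a) (c r) with hfdef
  have hf : LocallyLipschitzOn (Icc a b) f := by
    intro s hs
    obtain ⟨K, u, hu, hK⟩ := hc s hs
    exact exists_lipschitzOnWith_riemannianDist_comp (c a) (hcont s hs) hu hK
  obtain ⟨K1, hK1⟩ := hf.exists_lipschitzOnWith_of_compact isCompact_Icc
  obtain ⟨K2, hK2⟩ := hτ.exists_lipschitzOnWith_of_compact isCompact_Icc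
  rw [← uIcc_of_le hab.le] at hK1 hK2
  have hfac := hK1.absolutelyContinuousOnInterval
  have hτac := hK2.absolutelyContinuousOnInterval
  have hle : ∫ s in a..b, deriv f s ≤ ∫ s in a..b, deriv τ s := by
    refine intervalIntegral.integral_mono_ae_restrict hab.le hfac.intervalIntegrable_deriv
      hτac.intervalIntegrable_deriv ?_
    rw [← restrict_Ioo_eq_restrict_Icc, Filter.EventuallyLE, ae_restrict_iff' measurableSet_Ioo]
    filter_upwards [hae, hfac.ae_differentiableAt] with s h1 h2 hs
    obtain ⟨h3, -, h4⟩ := h1 hs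
    exact (deriv_riemannianDist_comp_le (c a) h3
      (h2 (by rw [uIcc_of_le hab.le]; exact Ioo_subset_Icc_self hs))).trans h4
  rw [hfac.integral_deriv_eq_sub, hτac.integral_deriv_eq_sub] at hle
  simpa [hfdef, riemannianDist_self] using hle

end DistanceAlongCurves

/-! ### Causal vectors of the product metric -/

section CausalVectors

variable {E : Type*} [NormedAddCommGroup E] [NormedSpace ℝ E]
  {S : Type*} [TopologicalSpace S] [ChartedSpace E S]

lemma dtForm_apply (p : ℝ × S) (v : TangentSpace (𝓘(ℝ, ℝ).prod 𝓘(ℝ, E)) p) :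
    dtForm 𝓘(ℝ, E) p v = (v : ℝ × E).1 := by
  simp only [dtForm, mfderiv_fst]
  rfl

lemma dProj_apply (p : ℝ × S) (v : TangentSpace (𝓘(ℝ, ℝ).prod 𝓘(ℝ, E)) p) :
    dProj 𝓘(ℝ, E) p v = (v : ℝ × E).2 := by
  simp only [dProj, mfderiv_snd]
  rfl

lemma dtForm_mfderiv {γ : ℝ → ℝ × S} {s : ℝ}
    (hγ : MDifferentiableAt 𝓘(ℝ, ℝ) (𝓘(ℝ, ℝ).prod 𝓘(ℝ, E)) γ s) :
    HasDerivAt (fun r => (γ r).1)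
      (dtForm 𝓘(ℝ, E) (γ s) (mfderiv 𝓘(ℝ, ℝ) (𝓘(ℝ, ℝ).prod 𝓘(ℝ, E)) γ s (1 : ℝ))) s := by
  have h := HasMFDerivAt.comp s (mdifferentiableAt_fst (I := 𝓘(ℝ, ℝ)) (I' := 𝓘(ℝ, E))
    (x := γ s)).hasMFDerivAt hγ.hasMFDerivAt
  have h' : HasFDerivAt (fun r => (γ r).1) (_ : ℝ →L[ℝ] ℝ) s := h.hasFDerivAt
  exact h'.hasDerivAt

lemma mdifferentiableAt_snd_comp {γ : ℝ → ℝ × S} {s : ℝ}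
    (hγ : MDifferentiableAt 𝓘(ℝ, ℝ) (𝓘(ℝ, ℝ).prod 𝓘(ℝ, E)) γ s) :
    MDifferentiableAt 𝓘(ℝ, ℝ) 𝓘(ℝ, E) (fun r => (γ r).2) s :=
  MDifferentiableAt.comp s (mdifferentiableAt_snd (I := 𝓘(ℝ, ℝ)) (I' := 𝓘(ℝ, E))
    (x := γ s)) hγ

lemma dProj_mfderiv {γ : ℝ → ℝ × S} {s : ℝ}
    (hγ : MDifferentiableAt 𝓘(ℝ, ℝ) (𝓘(ℝ, ℝ).prod 𝓘(ℝ, E)) γ s) :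
    dProj 𝓘(ℝ, E) (γ s) (mfderiv 𝓘(ℝ, ℝ) (𝓘(ℝ, ℝ).prod 𝓘(ℝ, E)) γ s (1 : ℝ)) =
      mfderiv 𝓘(ℝ, ℝ) 𝓘(ℝ, E) (fun r => (γ r).2) s (1 : ℝ) := by
  have h := HasMFDerivAt.comp s (mdifferentiableAt_snd (I := 𝓘(ℝ, ℝ)) (I' := 𝓘(ℝ, E))
    (x := γ s)).hasMFDerivAt hγ.hasMFDerivAt
  exact (congrArg (fun L => L (1 : ℝ)) h.mfderiv).symm

variable [RiemannianBundle (fun x : S => TangentSpace 𝓘(ℝ, E) x)]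

lemma productMetric_self (p : ℝ × S) (v : TangentSpace (𝓘(ℝ, ℝ).prod 𝓘(ℝ, E)) p) :
    productMetric 𝓘(ℝ, E) p v v = -(dtForm 𝓘(ℝ, E) p v) ^ 2 + ‖dProj 𝓘(ℝ, E) p v‖ ^ 2 := by
  simp only [productMetric, LinearMap.mk₂_apply, real_inner_self_eq_norm_sq]
  ring

lemma productMetric_timeField (p : ℝ × S) (v : TangentSpace (𝓘(ℝ, ℝ).prod 𝓘(ℝ, E)) p) :
    productMetric 𝓘(ℝ, E) p v (timeField 𝓘(ℝ, E) p) = -dtForm 𝓘(ℝ, E) p v := by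
  have h1 : dtForm 𝓘(ℝ, E) p (timeField 𝓘(ℝ, E) p) = 1 := dtForm_apply p _
  have h2 : dProj 𝓘(ℝ, E) p (timeField 𝓘(ℝ, E) p) = 0 := dProj_apply p _
  simp only [productMetric, LinearMap.mk₂_apply, h1, h2, inner_zero_right]
  ring

/-- The sign of `dt(v)` permits taking square roots in `‖v_Σ‖² ≤ dt(v)²`, and it already forces `v ≠
0`. -/
lemma isFutureCausalVector_iff (p : ℝ × S) (v : TangentSpace (𝓘(ℝ, ℝ).prod 𝓘(ℝ, E)) p) :
    IsFutureCausalVector (productMetric 𝓘(ℝ, E)) (timeField 𝓘(ℝ, E)) p v ↔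
      0 < dtForm 𝓘(ℝ, E) p v ∧ ‖dProj 𝓘(ℝ, E) p v‖ ≤ dtForm 𝓘(ℝ, E) p v := by
  rw [IsFutureCausalVector, IsCausalVector, productMetric_self, productMetric_timeField]
  constructor
  · rintro ⟨⟨-, h1⟩, h2⟩
    exact ⟨by linarith, (sq_le_sq₀ (norm_nonneg _) (by linarith)).1 (by linarith)⟩
  · rintro ⟨h1, h2⟩
    refine ⟨⟨?_, ?_⟩, by linarith⟩
    · rintro rfl
      simp at h1
    · have := pow_le_pow_left₀ (norm_nonneg _) h2 2
      linarith

lemma isPastCausalVector_iff (p : ℝ × S) (v : TangentSpace (𝓘(ℝ, ℝ).prod 𝓘(ℝ, E)) p) :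
    IsPastCausalVector (productMetric 𝓘(ℝ, E)) (timeField 𝓘(ℝ, E)) p v ↔
      dtForm 𝓘(ℝ, E) p v < 0 ∧ ‖dProj 𝓘(ℝ, E) p v‖ ≤ -dtForm 𝓘(ℝ, E) p v := by
  rw [IsPastCausalVector, IsCausalVector, productMetric_self, productMetric_timeField]
  constructor
  · rintro ⟨⟨-, h1⟩, h2⟩
    refine ⟨by linarith, (sq_le_sq₀ (norm_nonneg _) (by linarith)).1 ?_⟩
    rw [neg_sq]
    linarith
  · rintro ⟨h1, h2⟩
    refine ⟨⟨?_, ?_⟩, by linarith⟩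
    · rintro rfl
      simp at h1
    · have := pow_le_pow_left₀ (norm_nonneg _) h2 2
      rw [neg_sq] at this
      linarith

end CausalVectors

/-! ### Causal curves and the time they consume -/

section CausalCurves

variable {E : Type*} [NormedAddCommGroup E] [NormedSpace ℝ E]

/-- This and `ae_velocity_congr` serve to glue causal pieces, each the restriction of a curve
defined on all of `ℝ`. -/
lemma IsLocallyLipschitzCurve.congr {H : Type*} [TopologicalSpace H]
    {I : ModelWithCorners ℝ E H} {M : Type*} [TopologicalSpace M] [ChartedSpace H M]
    {γ γ' : ℝ → M} {a b : ℝ} (h : IsLocallyLipschitzCurve I γ a b) (he : EqOn γ γ' (Icc a b)) :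
    IsLocallyLipschitzCurve I γ' a b := by
  refine ⟨h.1.congr he.symm, fun s hs => ?_⟩
  obtain ⟨K, u, hu, hK⟩ := h.2 s hs
  refine ⟨K, u ∩ Icc a b, Filter.inter_mem hu self_mem_nhdsWithin, ?_⟩
  intro r hr q hq
  simp only [← he hs, ← he hr.2, ← he hq.2]
  exact hK hr.1 hq.1

lemma ae_velocity_congr {H : Type*} [TopologicalSpace H]
    {I : ModelWithCorners ℝ E H} {M : Type*} [TopologicalSpace M] [ChartedSpace H M]
    {γ γ' : ℝ → M} {a b : ℝ} {P : ∀ x : M, TangentSpace I x → Prop}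
    (h : ∀ᵐ s : ℝ, s ∈ Ioo a b → MDifferentiableAt 𝓘(ℝ, ℝ) I γ s ∧
      P (γ s) (mfderiv 𝓘(ℝ, ℝ) I γ s (1 : ℝ))) (he : EqOn γ γ' (Icc a b)) :
    ∀ᵐ s : ℝ, s ∈ Ioo a b → MDifferentiableAt 𝓘(ℝ, ℝ) I γ' s ∧
      P (γ' s) (mfderiv 𝓘(ℝ, ℝ) I γ' s (1 : ℝ)) := by
  filter_upwards [h] with s hs hmem
  have hev : γ' =ᶠ[𝓝 s] γ := by
    filter_upwards [isOpen_Ioo.mem_nhds hmem] with r hr using (he (Ioo_subset_Icc_self hr)).symm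
  obtain ⟨h1, h2⟩ := hs hmem
  refine ⟨h1.congr_of_eventuallyEq hev, ?_⟩
  -- The two velocities belong to different fibres as types, so they are compared in the model space
  -- `E`.
  have key : ∀ (x : M) (_ : x = γ s) (v : E), @Eq E v (mfderiv 𝓘(ℝ, ℝ) I γ s (1 : ℝ)) → P x v := by
    rintro x rfl v rfl
    exact h2
  exact key _ hev.eq_of_nhds _ (congrArg (fun L : ℝ →L[ℝ] E => L (1 : ℝ)) hev.mfderiv_eq)

variable {S : Type*} [TopologicalSpace S] [ChartedSpace E S]

/-- The chart of `ℝ × S` is a product with the identity in the first factor, and projections are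
`1`-Lipschitz. -/
lemma IsLocallyLipschitzCurve.fst {γ : ℝ → ℝ × S} {a b : ℝ}
    (h : IsLocallyLipschitzCurve (𝓘(ℝ, ℝ).prod 𝓘(ℝ, E)) γ a b) :
    LocallyLipschitzOn (Icc a b) fun r => (γ r).1 := by
  intro s hs
  obtain ⟨K, u, hu, hK⟩ := h.2 s hs
  refine ⟨K, u, hu, ?_⟩
  have := (LipschitzWith.prod_fst (α := ℝ) (β := E)).comp_lipschitzOnWith hK
  rw [one_mul] at this
  exact this

lemma IsLocallyLipschitzCurve.snd {γ : ℝ → ℝ × S} {a b : ℝ}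
    (h : IsLocallyLipschitzCurve (𝓘(ℝ, ℝ).prod 𝓘(ℝ, E)) γ a b) :
    IsLocallyLipschitzCurve 𝓘(ℝ, E) (fun r => (γ r).2) a b := by
  refine ⟨continuous_snd.comp_continuousOn h.1, fun s hs => ?_⟩
  obtain ⟨K, u, hu, hK⟩ := h.2 s hs
  refine ⟨K, u, hu, ?_⟩
  have := (LipschitzWith.prod_snd (α := ℝ) (β := E)).comp_lipschitzOnWith hK
  rw [one_mul] at this
  exact this

lemma ContMDiff.isLocallyLipschitzCurve [IsManifold 𝓘(ℝ, E) 1 S] {γ : ℝ → ℝ × S}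
    (hγ : ContMDiff 𝓘(ℝ, ℝ) (𝓘(ℝ, ℝ).prod 𝓘(ℝ, E)) 1 γ) (a b : ℝ) :
    IsLocallyLipschitzCurve (𝓘(ℝ, ℝ).prod 𝓘(ℝ, E)) γ a b := by
  refine ⟨hγ.continuous.continuousOn, fun s _ => ?_⟩
  have h := (contMDiffAt_extChartAt (I := 𝓘(ℝ, ℝ).prod 𝓘(ℝ, E)) (n := 1) (x := γ s)).comp s (hγ s)
  have h' : ContDiffAt ℝ 1 (fun r => extChartAt (𝓘(ℝ, ℝ).prod 𝓘(ℝ, E)) (γ s) (γ r)) s :=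
    contMDiffAt_iff_contDiffAt.1 h
  obtain ⟨K, u, hu, hK⟩ := h'.exists_lipschitzOnWith
  exact ⟨K, u, mem_nhdsWithin_of_mem_nhds hu, hK⟩

variable [IsManifold 𝓘(ℝ, E) 1 S]
  [RiemannianBundle (fun x : S => TangentSpace 𝓘(ℝ, E) x)]

lemma isFutureCausalCurve_of_speed_le {τ : ℝ → ℝ} {η : ℝ → S} {a b : ℝ} (hab : a < b)
    (hτ : ContDiff ℝ 1 τ) (hη : ContMDiff 𝓘(ℝ, ℝ) 𝓘(ℝ, E) 1 η) (hpos : ∀ s, 0 < deriv τ s)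
    (hle : ∀ s, ‖mfderiv 𝓘(ℝ, ℝ) 𝓘(ℝ, E) η s (1 : ℝ)‖ ≤ deriv τ s) :
    IsFutureCausalCurve (productMetric 𝓘(ℝ, E)) (timeField 𝓘(ℝ, E)) (fun s => (τ s, η s)) a b := by
  have hγ : ContMDiff 𝓘(ℝ, ℝ) (𝓘(ℝ, ℝ).prod 𝓘(ℝ, E)) 1 (fun s => (τ s, η s)) :=
    hτ.contMDiff.prodMk hη
  refine ⟨hab, hγ.isLocallyLipschitzCurve a b, .of_forall fun s _ => ?_⟩
  have hd := hγ.mdifferentiableAt one_ne_zero (x := s)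
  refine ⟨hd, (isFutureCausalVector_iff _ _).2 ?_⟩
  rw [dProj_mfderiv hd, ← (dtForm_mfderiv hd).deriv]
  exact ⟨hpos s, hle s⟩

lemma isPastCausalCurve_of_speed_le {τ : ℝ → ℝ} {η : ℝ → S} {a b : ℝ} (hab : a < b)
    (hτ : ContDiff ℝ 1 τ) (hη : ContMDiff 𝓘(ℝ, ℝ) 𝓘(ℝ, E) 1 η) (hneg : ∀ s, deriv τ s < 0)
    (hle : ∀ s, ‖mfderiv 𝓘(ℝ, ℝ) 𝓘(ℝ, E) η s (1 : ℝ)‖ ≤ -deriv τ s) :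
    IsPastCausalCurve (productMetric 𝓘(ℝ, E)) (timeField 𝓘(ℝ, E)) (fun s => (τ s, η s)) a b := by
  have hγ : ContMDiff 𝓘(ℝ, ℝ) (𝓘(ℝ, ℝ).prod 𝓘(ℝ, E)) 1 (fun s => (τ s, η s)) :=
    hτ.contMDiff.prodMk hη
  refine ⟨hab, hγ.isLocallyLipschitzCurve a b, .of_forall fun s _ => ?_⟩
  have hd := hγ.mdifferentiableAt one_ne_zero (x := s)
  refine ⟨hd, (isPastCausalVector_iff _ _).2 ?_⟩
  rw [dProj_mfderiv hd, ← (dtForm_mfderiv hd).deriv]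
  exact ⟨hneg s, hle s⟩

variable [IsContinuousRiemannianBundle E (fun x : S => TangentSpace 𝓘(ℝ, E) x)] [ConnectedSpace S]

lemma IsFutureCausalCurve.riemannianDist_le {γ : ℝ → ℝ × S} {a b : ℝ}
    (h : IsFutureCausalCurve (productMetric 𝓘(ℝ, E)) (timeField 𝓘(ℝ, E)) γ a b) :
    riemannianDist 𝓘(ℝ, E) (γ a).2 (γ b).2 ≤ (γ b).1 - (γ a).1 := by
  obtain ⟨hab, hlip, hae⟩ := h
  refine riemannianDist_le_sub_of_speed_le_deriv hab hlip.snd.1 hlip.snd.2 hlip.fst ?_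
  filter_upwards [hae] with s hs hmem
  obtain ⟨h1, h2⟩ := hs hmem
  rw [isFutureCausalVector_iff, dProj_mfderiv h1, ← (dtForm_mfderiv h1).deriv] at h2
  exact ⟨mdifferentiableAt_snd_comp h1, (dtForm_mfderiv h1).differentiableAt, h2.2⟩

/-- The comparison along curves applies with `-t` in the role of `τ`, so the curve need not be
reversed. -/
lemma IsPastCausalCurve.riemannianDist_le {γ : ℝ → ℝ × S} {a b : ℝ}
    (h : IsPastCausalCurve (productMetric 𝓘(ℝ, E)) (timeField 𝓘(ℝ, E)) γ a b) :
    riemannianDist 𝓘(ℝ, E) (γ a).2 (γ b).2 ≤ (γ a).1 - (γ b).1 := by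
  obtain ⟨hab, hlip, hae⟩ := h
  have hτ : LocallyLipschitzOn (Icc a b) fun r => -(γ r).1 := hlip.fst.neg
  have := riemannianDist_le_sub_of_speed_le_deriv (E := E) hab hlip.snd.1 hlip.snd.2 hτ ?_
  · linarith
  filter_upwards [hae] with s hs hmem
  obtain ⟨h1, h2⟩ := hs hmem
  rw [isPastCausalVector_iff, dProj_mfderiv h1, ← (dtForm_mfderiv h1).deriv] at h2
  refine ⟨mdifferentiableAt_snd_comp h1, (dtForm_mfderiv h1).differentiableAt.neg, ?_⟩
  rw [deriv.fun_neg]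
  exact h2.2

end CausalCurves

/-! ### Zigzag curves, the null distance and the boundary of the future -/

section NullDistance

variable {E : Type*} [NormedAddCommGroup E] [NormedSpace ℝ E]
  {S : Type*} [TopologicalSpace S] [ChartedSpace E S] [IsManifold 𝓘(ℝ, E) 1 S]
  [RiemannianBundle (fun x : S => TangentSpace 𝓘(ℝ, E) x)]
  [IsContinuousRiemannianBundle E (fun x : S => TangentSpace 𝓘(ℝ, E) x)] [ConnectedSpace S]

/-- Points at distance less than `Λ` are joined by a `C¹` curve whose speed is dominated by the
derivative of a strictly increasing function of total variation `Λ`. -/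
lemma exists_curve_speed_le {x y : S} {Λ : ℝ} (h : riemannianDist 𝓘(ℝ, E) x y < Λ) :
    ∃ (η : ℝ → S) (F : ℝ → ℝ), η 0 = x ∧ η 1 = y ∧ ContMDiff 𝓘(ℝ, ℝ) 𝓘(ℝ, E) 1 η ∧
      F 0 = 0 ∧ F 1 = Λ ∧ ContDiff ℝ 1 F ∧ (∀ s, 0 < deriv F s) ∧
      ∀ s, ‖mfderiv 𝓘(ℝ, ℝ) 𝓘(ℝ, E) η s (1 : ℝ)‖ ≤ deriv F s := by
  have h' : riemannianEDist 𝓘(ℝ, E) x y < ENNReal.ofReal Λ :=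
    (ENNReal.lt_ofReal_iff_toReal_lt (riemannianEDist_ne_top x y)).2 h
  obtain ⟨η, h0, h1, hη, hlen, -⟩ :=
    exists_lt_locally_constant_of_riemannianEDist_lt h' (zero_lt_one (α := ℝ))
  set f : ℝ → ℝ := fun s => ‖mfderiv 𝓘(ℝ, ℝ) 𝓘(ℝ, E) η s (1 : ℝ)‖ with hf
  have hfc : Continuous f := hη.continuous_speed
  have hint : ∫ s in (0 : ℝ)..1, f s < Λ := by
    refine (ENNReal.ofReal_lt_ofReal_iff_of_nonneg (intervalIntegral.integral_nonneg zero_le_one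
      fun s _ => norm_nonneg _)).1 (lt_of_eq_of_lt ?_ hlen)
    rw [pathELength_eq_lintegral_mfderiv_Icc, intervalIntegral.integral_of_le zero_le_one,
      ← integral_Icc_eq_integral_Ioc, ofReal_integral_eq_lintegral_ofReal
      (hfc.integrableOn_Icc) (.of_forall fun s => norm_nonneg _)]
    simp only [hf, ofReal_norm]
    rfl
  -- The spare length is spread uniformly over `[0, 1]`: it makes `F' = f + ε` positive even where
  -- the curve stops, and makes `F 1` exactly `Λ`.
  set ε := Λ - ∫ s in (0 : ℝ)..1, f s with hε
  have hε0 : 0 < ε := sub_pos.2 hint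
  have hgc : Continuous fun s => f s + ε := hfc.add continuous_const
  have hderiv : ∀ s, HasDerivAt (fun u => ∫ r in (0 : ℝ)..u, (f r + ε)) (f s + ε) s := fun s =>
    hgc.integral_hasStrictDerivAt 0 s |>.hasDerivAt
  have hderiv' : deriv (fun u => ∫ r in (0 : ℝ)..u, (f r + ε)) = fun s => f s + ε :=
    funext fun s => (hderiv s).deriv
  refine ⟨η, fun u => ∫ r in (0 : ℝ)..u, (f r + ε), h0, h1, hη, by simp, ?_, ?_, ?_, ?_⟩
  · beta_reduce
    rw [intervalIntegral.integral_add (hfc.intervalIntegrable _ _) (by simp)]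
    simp [hε]
  · rw [contDiff_one_iff_deriv, hderiv']
    exact ⟨fun s => (hderiv s).differentiableAt, hgc⟩
  · rw [hderiv']
    exact fun s => add_pos_of_nonneg_of_pos (norm_nonneg _) hε0
  · rw [hderiv']
    exact fun s => le_add_of_nonneg_right hε0.le

/-- Strictness leaves room for a `C¹` curve shorter than the time difference; lifting it by the
clock `F` makes it causal. -/
lemma mem_causalFuture_of_riemannianDist_lt {p q : ℝ × S}
    (h : riemannianDist 𝓘(ℝ, E) p.2 q.2 < q.1 - p.1) :
    q ∈ causalFuture (productMetric 𝓘(ℝ, E)) (timeField 𝓘(ℝ, E)) p := by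
  obtain ⟨η, F, h0, h1, hη, hF0, hF1, hF, hpos, hle⟩ := exists_curve_speed_le h
  refine Or.inr ⟨fun s => (p.1 + F s, η s), 0, 1, isFutureCausalCurve_of_speed_le zero_lt_one
    (contDiff_const.add hF) hη ?_ ?_, ?_, ?_⟩
  · simpa using hpos
  · simpa using hle
  · simp [h0, hF0]
  · simp [h1, hF1]

lemma riemannianDist_le_of_mem_causalFuture {p q : ℝ × S}
    (h : q ∈ causalFuture (productMetric 𝓘(ℝ, E)) (timeField 𝓘(ℝ, E)) p) :
    riemannianDist 𝓘(ℝ, E) p.2 q.2 ≤ q.1 - p.1 := by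
  rcases h with rfl | ⟨γ, a, b, hγ, rfl, rfl⟩
  · simp [riemannianDist_self]
  · exact hγ.riemannianDist_le

/-- Every `Λ` beyond the time difference and the distance is the null length of a curve that
consists of a future directed and a past directed piece. -/
lemma mem_nullLengths_of_lt {p q : ℝ × S} {Λ : ℝ} (ht : |q.1 - p.1| < Λ)
    (hd : riemannianDist 𝓘(ℝ, E) p.2 q.2 < Λ) :
    Λ ∈ nullLengths (productMetric 𝓘(ℝ, E)) (timeField 𝓘(ℝ, E)) timeCoord p q := by
  obtain ⟨η, F, h0, h1, hη, hF0, hF1, hF, hpos, hle⟩ := exists_curve_speed_le hd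
  obtain ⟨ht1, ht2⟩ := abs_lt.1 ht
  -- Turning at parameter `m` gives the net time change `F m - (Λ - F m)`, which has to be `q.1 -
  -- p.1`. The bound on the time difference puts this value of `F m` strictly between `0` and `Λ`.
  obtain ⟨m, ⟨hm0, hm1⟩, hFm⟩ : (Λ + (q.1 - p.1)) / 2 ∈ F '' Ioo 0 1 :=
    intermediate_value_Ioo zero_le_one hF.continuous.continuousOn
      ⟨by rw [hF0]; linarith, by rw [hF1]; linarith⟩
  have hup : IsFutureCausalCurve (productMetric 𝓘(ℝ, E)) (timeField 𝓘(ℝ, E))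
      (fun s => (p.1 + F s, η s)) 0 m :=
    isFutureCausalCurve_of_speed_le hm0 (contDiff_const.add hF) hη (by simpa using hpos)
      (by simpa using hle)
  -- The time coordinate is reflected at the level `p.1 + F m`, so the two pieces meet at `m`.
  have hdown : IsPastCausalCurve (productMetric 𝓘(ℝ, E)) (timeField 𝓘(ℝ, E))
      (fun s => (p.1 + 2 * F m - F s, η s)) m 1 :=
    isPastCausalCurve_of_speed_le hm1 (contDiff_const.sub hF) hη (by simpa using hpos)
      (by simpa using hle)
  set β : ℝ → ℝ × S := fun s => (if s ≤ m then p.1 + F s else p.1 + 2 * F m - F s, η s) with hβ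
  have e1 : EqOn (fun s => (p.1 + F s, η s)) β (Icc 0 m) := fun s hs => by
    simp [hβ, hs.2]
  have e2 : EqOn (fun s => (p.1 + 2 * F m - F s, η s)) β (Icc m 1) := fun s hs => by
    rcases hs.1.eq_or_lt with rfl | hlt
    · simp only [hβ, le_refl, if_true]
      rw [show p.1 + 2 * F m - F m = p.1 + F m by ring]
    · simp [hβ, hlt.not_ge]
  have hβ0 : β 0 = (p.1, p.2) := by rw [← e1 ⟨le_rfl, hm0.le⟩]; simp [h0, hF0]
  have hβm : β m = (p.1 + F m, η m) := (e1 ⟨hm0.le, le_rfl⟩).symm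
  have hβ1 : β 1 = (q.1, q.2) := by
    rw [← e2 ⟨hm1.le, le_rfl⟩]
    simp only [h1, hF1, hFm]
    rw [show p.1 + 2 * ((Λ + (q.1 - p.1)) / 2) - Λ = q.1 by ring]
  refine ⟨β, 2, fun i => if i = 0 then 0 else if i = 1 then m else 1, ⟨by norm_num, ?_⟩, ?_, ?_, ?_⟩
  · intro i hi
    interval_cases i
    · exact Or.inl ⟨hm0, hup.2.1.congr e1, ae_velocity_congr
        (P := IsFutureCausalVector (productMetric 𝓘(ℝ, E)) (timeField 𝓘(ℝ, E))) hup.2.2 e1⟩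
    · exact Or.inr ⟨hm1, hdown.2.1.congr e2, ae_velocity_congr
        (P := IsPastCausalVector (productMetric 𝓘(ℝ, E)) (timeField 𝓘(ℝ, E))) hdown.2.2 e2⟩
  · simpa using hβ0
  · simpa using hβ1
  · simp only [nullLength, Finset.sum_range_succ, Finset.sum_range_zero, timeCoord]
    norm_num [hβ0, hβm, hβ1]
    rw [hFm, abs_of_pos (by linarith), abs_of_neg (by linarith)]
    ring

/-- On each piece `|Δt|` dominates the spatial distance of the endpoints; induction over initial
segments of the partition adds up both triangle inequalities. -/
lemma max_le_of_mem_nullLengths {p q : ℝ × S} {L : ℝ}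
    (h : L ∈ nullLengths (productMetric 𝓘(ℝ, E)) (timeField 𝓘(ℝ, E)) timeCoord p q) :
    max |q.1 - p.1| (riemannianDist 𝓘(ℝ, E) p.2 q.2) ≤ L := by
  obtain ⟨β, k, a, ⟨-, hβ⟩, rfl, rfl, rfl⟩ := h
  have key : ∀ j ≤ k, |(β (a j)).1 - (β (a 0)).1| ≤ nullLength timeCoord β j a ∧
      riemannianDist 𝓘(ℝ, E) (β (a 0)).2 (β (a j)).2 ≤ nullLength timeCoord β j a := by
    intro j
    induction j with
    | zero => simp [nullLength, riemannianDist_self]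
    | succ j ih =>
      intro hj
      obtain ⟨i1, i2⟩ := ih (by omega)
      rw [nullLength, Finset.sum_range_succ, ← nullLength]
      simp only [timeCoord] at i1 i2 ⊢
      refine ⟨?_, (riemannianDist_triangle _ (β (a j)).2 _).trans (add_le_add i2 ?_)⟩
      · rw [← sub_add_sub_cancel' _ (β (a 0)).1 (β (a (j + 1))).1]
        exact (abs_add_le _ _).trans (add_le_add i1 le_rfl)
      · rcases hβ j (by omega) with h | h
        · exact h.riemannianDist_le.trans (le_abs_self _)
        · exact h.riemannianDist_le.trans (by rw [abs_sub_comm]; exact le_abs_self _)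
  exact max_le (key k le_rfl).1 (key k le_rfl).2

lemma nullLengths_nonempty (p q : ℝ × S) :
    (nullLengths (productMetric 𝓘(ℝ, E)) (timeField 𝓘(ℝ, E)) timeCoord p q).Nonempty :=
  ⟨max |q.1 - p.1| (riemannianDist 𝓘(ℝ, E) p.2 q.2) + 1, mem_nullLengths_of_lt
    ((le_max_left _ _).trans_lt (lt_add_one _)) ((le_max_right _ _).trans_lt (lt_add_one _))⟩

/-- The null distance of the time function of a Lorentzian product. -/
lemma nullDist_timeCoord (p q : ℝ × S) :
    nullDist (productMetric 𝓘(ℝ, E)) (timeField 𝓘(ℝ, E)) timeCoord p q =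
      max |q.1 - p.1| (riemannianDist 𝓘(ℝ, E) p.2 q.2) := by
  refine csInf_eq_of_forall_ge_of_forall_gt_exists_lt (nullLengths_nonempty p q)
    (fun L hL => max_le_of_mem_nullLengths hL) fun Λ hΛ => ?_
  obtain ⟨Λ', h1, h2⟩ := exists_between hΛ
  exact ⟨Λ', mem_nullLengths_of_lt ((le_max_left _ _).trans_lt h1)
    ((le_max_right _ _).trans_lt h1), h2⟩

/-- The boundary of the causal future in a Lorentzian product. -/
lemma mem_frontier_causalFuture_iff (p q : ℝ × S) :
    q ∈ frontier (causalFuture (productMetric 𝓘(ℝ, E)) (timeField 𝓘(ℝ, E)) p) ↔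
      q.1 - p.1 = riemannianDist 𝓘(ℝ, E) p.2 q.2 := by
  have hd : Continuous fun q : ℝ × S => riemannianDist 𝓘(ℝ, E) p.2 q.2 :=
    (continuous_riemannianDist p.2).comp continuous_snd
  have ht : Continuous fun q : ℝ × S => q.1 - p.1 := continuous_fst.sub continuous_const
  constructor
  · rintro ⟨hcl, hint⟩
    -- The open set `d < Δt` lies in the interior of the future, and the closed set `d ≤ Δt`
    -- contains its closure.
    refine le_antisymm ?_ ?_
    · by_contra! hlt
      exact hint (interior_maximal (fun _ => mem_causalFuture_of_riemannianDist_lt)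
        (isOpen_lt hd ht) hlt)
    · exact closure_minimal (fun _ => riemannianDist_le_of_mem_causalFuture)
        (isClosed_le hd ht) hcl
  · intro heq
    -- On the vertical line through `q`, points above `q` satisfy `d < Δt` and lie in the future,
    -- while points below violate `d ≤ Δt` and do not.
    have hline : Filter.Tendsto (fun s : ℝ => ((s, q.2) : ℝ × S)) (𝓝 q.1) (𝓝 q) :=
      (Continuous.prodMk_left q.2).tendsto q.1
    constructor
    · refine mem_closure_of_tendsto (hline.mono_left nhdsWithin_le_nhds) (b := 𝓝[>] q.1) ?_
      filter_upwards [self_mem_nhdsWithin] with s (hs : q.1 < s)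
      refine mem_causalFuture_of_riemannianDist_lt (E := E) ?_
      simp only
      linarith
    · intro hq
      have h1 : ∀ᶠ s in 𝓝[<] q.1, ((s, q.2) : ℝ × S) ∈
          causalFuture (productMetric 𝓘(ℝ, E)) (timeField 𝓘(ℝ, E)) p :=
        (hline.mono_left nhdsWithin_le_nhds).eventually (mem_interior_iff_mem_nhds.1 hq)
      obtain ⟨s, hs1, hs2 : s < q.1⟩ := (h1.and self_mem_nhdsWithin).exists
      have := riemannianDist_le_of_mem_causalFuture hs1
      simp only at this
      linarith

end NullDistance

theorem mainTheorem10 {E : Type*} [NormedAddCommGroup E] [NormedSpace ℝ E] [FiniteDimensional ℝ E]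
    {S : Type*} [TopologicalSpace S] [T2Space S] [SecondCountableTopology S] [ConnectedSpace S]
    [ChartedSpace E S] [IsManifold 𝓘(ℝ, E) ∞ S]
    [RiemannianBundle (fun x : S => TangentSpace 𝓘(ℝ, E) x)]
    [IsContMDiffRiemannianBundle 𝓘(ℝ, E) ∞ E (fun x : S => TangentSpace 𝓘(ℝ, E) x)] :
    (∀ p q : ℝ × S,
      riemannianEDist 𝓘(ℝ, E) p.2 q.2 ≠ ⊤ ∧
      (nullLengths (productMetric 𝓘(ℝ, E)) (timeField 𝓘(ℝ, E)) timeCoord p q).Nonempty ∧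
      nullDist (productMetric 𝓘(ℝ, E)) (timeField 𝓘(ℝ, E)) timeCoord p q =
        max |timeCoord q - timeCoord p| (riemannianDist 𝓘(ℝ, E) p.2 q.2)) ∧
    (∀ p q : ℝ × S,
      q ∈ frontier (causalFuture (productMetric 𝓘(ℝ, E)) (timeField 𝓘(ℝ, E)) p) ↔
        timeCoord q - timeCoord p =
            nullDist (productMetric 𝓘(ℝ, E)) (timeField 𝓘(ℝ, E)) timeCoord p q ∧
          nullDist (productMetric 𝓘(ℝ, E)) (timeField 𝓘(ℝ, E)) timeCoord p q =
            riemannianDist 𝓘(ℝ, E) p.2 q.2) := by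
  have hcont : IsContinuousRiemannianBundle E (fun x : S => TangentSpace 𝓘(ℝ, E) x) := by
    obtain ⟨g, hg, h⟩ := IsContMDiffRiemannianBundle.exists_contMDiff (IB := 𝓘(ℝ, E)) (n := ∞)
      (F := E) (E := fun x : S => TangentSpace 𝓘(ℝ, E) x)
    exact ⟨g, hg.continuous, h⟩
  refine ⟨fun p q => ⟨riemannianEDist_ne_top p.2 q.2, nullLengths_nonempty p q,
    nullDist_timeCoord p q⟩, fun p q => ?_⟩
  rw [mem_frontier_causalFuture_iff, nullDist_timeCoord]
  simp only [timeCoord]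
  have h0 := riemannianDist_nonneg (E := E) p.2 q.2
  -- If `Δt = d`, then `Δt ≥ 0` and both entries of the maximum equal `d`; the converse is
  -- transitivity.
  constructor
  · intro h
    rw [h, abs_of_nonneg h0, max_self]
    exact ⟨rfl, rfl⟩
  · rintro ⟨h1, h2⟩
    exact h1.trans h2
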